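/- Let $d\ge 1$ and $q\in(2,\infty)$. For $f\in L^1(\mathbb R^d)$ write $\widehat f(\xi)=\int_{\mathbb R^d}e^{-2\pi i x\cdot\xi}f(x)\,dx$, extended to $L^2(\mathbb R^d)$ by Plancherel's theorem. Let $\mathbb B=\{x\in\mathbb R^d:|x|\le 1\}$. For a Lebesgue measurable set $E\subset\mathbb R^d$ with measure $|E|\in(0,\infty)$ put $$\Phi_q(E)=|E|^{-1/q'}\,\|\widehat{\mathbf 1_E}\|_{L^q(\mathbb R^d)},\qquad q'=\frac{q}{q-1},$$ $$\operatorname{dist}(E,\mathfrak E)=\inf_{\mathcal E}\frac{|\mathcal E\,\triangle\,E|}{|E|},$$ where the infimum is over all ellipsoids $\mathcal E$ (images of $\mathbb B$ under affine automorphisms of $\mathbb R^d$) with $|\mathcal E|=|E|$. Say that ellipsoids are local maximizers of $\Phi_q$ if there is $\eta>0$ such that $\Phi_q(\mathbb B)\ge\Phi_q(E)$ for every Lebesgue measurable $E\subset\mathbb R^d$ with $|E|\in(0,\infty)$ and $\operatorname{dist}(E,\mathfrak E)<\eta$. Let $K_q\in L^2(\mathbb R^d)$ be the real-valued function defined by $\widehat{K_q}=\widehat{\mathbf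 1_{\mathbb B}}\,|\widehat{\mathbf 1_{\mathbb B}}|^{q-2}$. If ellipsoids are local maximizers of $\Phi_q$, then $$\operatorname*{ess\,inf}_{|x|\le 1}K_q(x)\ \ge\ \operatorname*{ess\,sup}_{|x|\ge 1}K_q(x).$$ -/

import Mathlib

open MeasureTheory FourierTransform
open scoped ENNReal SchwartzMap symmDiff

noncomputable section

namespace FourierIndicator

/-- The indicator function `1_E`, as a complex-valued function on `ℝ^d`. -/
def ind {d : ℕ} (E : Set (EuclideanSpace ℝ (Fin d))) : EuclideanSpace ℝ (Fin d) → ℂ :=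
  E.indicator (fun _ => (1 : ℂ))

/-- The closed unit ball `𝔹` of `ℝ^d`. -/
def unitBall (d : ℕ) : Set (EuclideanSpace ℝ (Fin d)) := {x | ‖x‖ ≤ 1}

/-- An ellipsoid is the image of the closed unit ball under an affine automorphism of `ℝ^d`. -/
def IsEllipsoid {d : ℕ} (S : Set (EuclideanSpace ℝ (Fin d))) : Prop :=
  ∃ T : EuclideanSpace ℝ (Fin d) ≃ᵃ[ℝ] EuclideanSpace ℝ (Fin d), S = T '' unitBall d

/-- `Φ_q(E) = |E|^{-1/q'} ‖(1_E)^‖_{L^q}` with `q' = q/(q-1)`, as an extended nonnegative real.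
`𝓕` is the Fourier integral with kernel `exp(-2πi x·ξ)`. -/
def Phi {d : ℕ} (q : ℝ) (E : Set (EuclideanSpace ℝ (Fin d))) : ℝ≥0∞ :=
  volume E ^ (-(1 / (q / (q - 1)))) * eLpNorm (𝓕 (ind E)) (ENNReal.ofReal q) volume

/-- `dist(E, 𝔈)`: the infimum of `|S ∆ E| / |E|` over all ellipsoids `S` with `|S| = |E|`
(used for `0 < |E| < ∞`). -/
def distEllipsoids {d : ℕ} (E : Set (EuclideanSpace ℝ (Fin d))) : ℝ≥0∞ :=
  ⨅ (S : Set (EuclideanSpace ℝ (Fin d))) (_ : IsEllipsoid S) (_ : volume S = volume E),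
    volume (S ∆ E) / volume E

/-- Ellipsoids are local maximizers of `Φ_q` on `ℝ^d`. `NullMeasurableSet` is Lebesgue
measurability. -/
def EllipsoidsLocalMax (d : ℕ) (q : ℝ) : Prop :=
  ∃ η : ℝ, 0 < η ∧ ∀ E : Set (EuclideanSpace ℝ (Fin d)), NullMeasurableSet E volume →
    0 < volume E → volume E < ∞ → distEllipsoids E < ENNReal.ofReal η →
      Phi q E ≤ Phi q (unitBall d)

/-- The function `(1_𝔹)^ |(1_𝔹)^|^{q-2}` on `ℝ^d`. -/
def kernelHat (d : ℕ) (q : ℝ) (ξ : EuclideanSpace ℝ (Fin d)) : ℂ :=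
  𝓕 (ind (unitBall d)) ξ * ((‖𝓕 (ind (unitBall d)) ξ‖ ^ (q - 2) : ℝ) : ℂ)

/-- For `f ∈ L¹ ∩ L²` the Fourier integral of `f` represents the `L²` Fourier transform. -/
theorem fourier_ae_eq {d : ℕ} {f : EuclideanSpace ℝ (Fin d) → ℂ}
    (h1 : Integrable f) (h2 : MemLp f 2) :
    ((𝓕 (h2.toLp f) : Lp (α := EuclideanSpace ℝ (Fin d)) ℂ 2) :
      EuclideanSpace ℝ (Fin d) → ℂ) =ᵐ[volume] 𝓕 f := by
  have hcont : Continuous (𝓕 f) :=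
    VectorFourier.fourierIntegral_continuous Real.continuous_fourierChar
      (L := innerₗ (EuclideanSpace ℝ (Fin d))) continuous_inner h1
  apply ae_eq_of_integral_contDiff_smul_eq
  · exact (Lp.memLp _).locallyIntegrable (by norm_num)
  · exact hcont.locallyIntegrable
  intro g hg hgc
  have hg₁ : HasCompactSupport (Complex.ofRealCLM ∘ g) := hgc.comp_left rfl
  have hg₂ : ContDiff ℝ ((⊤ : ℕ∞) : WithTop ℕ∞) (Complex.ofRealCLM ∘ g) := by fun_prop
  set φ : 𝓢(EuclideanSpace ℝ (Fin d), ℂ) := hg₁.toSchwartzMap hg₂ with hφ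
  have hφx : ∀ x, φ x = (g x : ℂ) := fun x => rfl
  have key := congrArg (fun T => T φ) (Lp.fourier_toTemperedDistribution_eq (h2.toLp f))
  simp only [TemperedDistribution.fourier_apply, Lp.toTemperedDistribution_apply] at key
  have e1 : ∀ F : EuclideanSpace ℝ (Fin d) → ℂ, ∫ x, g x • F x = ∫ x, φ x • F x := by
    intro F; rfl
  rw [e1, e1, ← key]
  have e2 : ∫ x, (𝓕 φ) x • (h2.toLp f : EuclideanSpace ℝ (Fin d) → ℂ) x
      = ∫ x, (𝓕 (φ : EuclideanSpace ℝ (Fin d) → ℂ)) x • f x := by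
    apply integral_congr_ae
    filter_upwards [h2.coeFn_toLp] with x hx
    rw [hx, SchwartzMap.fourier_coe]
  rw [e2]
  have := VectorFourier.integral_fourierIntegral_smul_eq_flip
    (L := innerₗ (EuclideanSpace ℝ (Fin d))) (μ := volume) (ν := volume)
    Real.continuous_fourierChar continuous_inner φ.integrable h1
  rw [flip_innerₗ] at this
  exact this

theorem volume_unitBall_lt_top (d : ℕ) : volume (unitBall d) < ∞ := by
  have : unitBall d = Metric.closedBall 0 1 := by ext x; simp [unitBall]
  rw [this]; exact measure_closedBall_lt_top

theorem measurableSet_unitBall (d : ℕ) : MeasurableSet (unitBall d) :=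
  (isClosed_le continuous_norm continuous_const).measurableSet

theorem memLp_ind_unitBall (d : ℕ) (p : ℝ≥0∞) : MemLp (ind (unitBall d)) p :=
  memLp_indicator_const p (measurableSet_unitBall d) 1 (Or.inr (volume_unitBall_lt_top d).ne)

theorem integrable_ind_unitBall (d : ℕ) : Integrable (ind (unitBall d)) :=
  memLp_one_iff_integrable.1 (memLp_ind_unitBall d 1)

theorem continuous_fourier_ind (d : ℕ) : Continuous (𝓕 (ind (unitBall d))) :=
  VectorFourier.fourierIntegral_continuous Real.continuous_fourierChar
    (L := innerₗ (EuclideanSpace ℝ (Fin d))) continuous_inner (integrable_ind_unitBall d)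

theorem continuous_kernelHat (d : ℕ) {q : ℝ} (hq : 2 < q) : Continuous (kernelHat d q) :=
  (continuous_fourier_ind d).mul (Complex.continuous_ofReal.comp
    ((continuous_fourier_ind d).norm.rpow_const fun _ => Or.inr (by linarith)))

/-- `(1_𝔹)^ |(1_𝔹)^|^{q-2}` is square integrable. -/
theorem memLp_kernelHat (d : ℕ) {q : ℝ} (hq : 2 < q) : MemLp (kernelHat d q) 2 := by
  have h2 : MemLp (𝓕 (ind (unitBall d))) 2 :=
    (Lp.memLp _).ae_eq (fourier_ae_eq (integrable_ind_unitBall d) (memLp_ind_unitBall d 2))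
  refine h2.of_le_mul (c := (∫ x, ‖ind (unitBall d) x‖) ^ (q - 2))
    (continuous_kernelHat d hq).aestronglyMeasurable (Filter.Eventually.of_forall fun ξ => ?_)
  have hb : ‖𝓕 (ind (unitBall d)) ξ‖ ≤ ∫ x, ‖ind (unitBall d) x‖ :=
    VectorFourier.norm_fourierIntegral_le_integral_norm _ _ _ _ _
  rw [kernelHat, norm_mul, mul_comm, Complex.norm_real,
    Real.norm_of_nonneg (Real.rpow_nonneg (norm_nonneg _) _)]
  gcongr

/-- The element `K_q` of `L²(ℝ^d)` whose Fourier transform is `(1_𝔹)^ |(1_𝔹)^|^{q-2}`. -/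
def kernelLp (d : ℕ) (q : ℝ) (hq : 2 < q) : Lp (α := EuclideanSpace ℝ (Fin d)) ℂ 2 :=
  𝓕⁻ ((memLp_kernelHat d hq).toLp (kernelHat d q))

/-- The kernel `K_q` as a real-valued function (see `kernel_spec`). -/
def kernel (d : ℕ) (q : ℝ) (hq : 2 < q) (x : EuclideanSpace ℝ (Fin d)) : ℝ :=
  ((kernelLp d q hq : EuclideanSpace ℝ (Fin d) → ℂ) x).re

theorem conj_fourier_of_real {d : ℕ} {f : EuclideanSpace ℝ (Fin d) → ℂ}
    (hf : ∀ x, starRingEnd ℂ (f x) = f x) (ξ : EuclideanSpace ℝ (Fin d)) :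
    starRingEnd ℂ (𝓕 f ξ) = 𝓕 f (-ξ) := by
  rw [Real.fourier_eq', Real.fourier_eq', ← integral_conj]
  congr 1 with x
  simp only [smul_eq_mul, map_mul, hf, ← Complex.exp_conj, Complex.conj_ofReal, Complex.conj_I,
    inner_neg_right]
  simp

theorem conj_kernelHat (d : ℕ) (q : ℝ) (ξ : EuclideanSpace ℝ (Fin d)) :
    starRingEnd ℂ (kernelHat d q ξ) = kernelHat d q (-ξ) := by
  have h := conj_fourier_of_real (f := ind (unitBall d))
    (fun x => by by_cases hx : x ∈ unitBall d <;> simp [ind, hx]) ξ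
  rw [kernelHat, kernelHat, ← h, map_mul, Complex.conj_ofReal, RCLike.norm_conj]

/-- `K_q` is real-valued: `kernel` represents `kernelLp` almost everywhere. -/
theorem kernel_ae_eq (d : ℕ) (q : ℝ) (hq : 2 < q) :
    (fun x => ((kernel d q hq x : ℝ) : ℂ)) =ᵐ[volume]
      (kernelLp d q hq : EuclideanSpace ℝ (Fin d) → ℂ) := by
  set K : EuclideanSpace ℝ (Fin d) → ℂ := (kernelLp d q hq : EuclideanSpace ℝ (Fin d) → ℂ)
    with hK
  have hKloc : LocallyIntegrable K := (Lp.memLp _).locallyIntegrable (by norm_num)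
  have him : ∀ᵐ x, (K x).im = 0 := by
    apply ae_eq_zero_of_integral_contDiff_smul_eq_zero
    · intro x
      obtain ⟨s, hs, hi⟩ := hKloc x
      exact ⟨s, hs, hi.im⟩
    intro g hg hgc
    have hg₁ : HasCompactSupport (Complex.ofRealCLM ∘ g) := hgc.comp_left rfl
    have hg₂ : ContDiff ℝ ((⊤ : ℕ∞) : WithTop ℕ∞) (Complex.ofRealCLM ∘ g) := by fun_prop
    set φ : 𝓢(EuclideanSpace ℝ (Fin d), ℂ) := hg₁.toSchwartzMap hg₂ with hφ
    have hφx : ∀ x, φ x = (g x : ℂ) := fun x => rfl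
    have key := congrArg (fun T => T φ) (Lp.fourierInv_toTemperedDistribution_eq
      ((memLp_kernelHat d hq).toLp (kernelHat d q)))
    simp only [TemperedDistribution.fourierInv_apply, Lp.toTemperedDistribution_apply] at key
    have e2 : ∫ x, (𝓕⁻ φ) x • ((memLp_kernelHat d hq).toLp (kernelHat d q) :
        EuclideanSpace ℝ (Fin d) → ℂ) x
        = ∫ x, (𝓕 (φ : EuclideanSpace ℝ (Fin d) → ℂ)) (-x) • kernelHat d q x := by
      apply integral_congr_ae
      filter_upwards [(memLp_kernelHat d hq).coeFn_toLp] with x hx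
      rw [hx, SchwartzMap.fourierInv_coe, Real.fourierInv_eq_fourier_neg]
    rw [e2] at key
    have hreal : starRingEnd ℂ (∫ x, φ x • K x) = ∫ x, φ x • K x := by
      have key' : ∫ x, (𝓕 (φ : EuclideanSpace ℝ (Fin d) → ℂ)) (-x) • kernelHat d q x
        = ∫ x, φ x • K x := key
      rw [← key', ← integral_conj, ← integral_neg_eq_self]
      congr 1 with x
      have := conj_fourier_of_real (f := (φ : EuclideanSpace ℝ (Fin d) → ℂ))
        (fun x => by rw [hφx, Complex.conj_ofReal]) x
      simp only [smul_eq_mul, map_mul, neg_neg, this, conj_kernelHat]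
    have hint : Integrable (fun x => φ x • K x) := by
      have := hKloc.integrable_smul_left_of_hasCompactSupport hg.continuous hgc
      refine this.congr (Filter.Eventually.of_forall fun x => ?_)
      simp [hφx]
    have h0 := Complex.conj_eq_iff_im.1 hreal
    have h1 := integral_im hint
    calc ∫ x, g x • (K x).im = ∫ x, RCLike.im (φ x • K x) := by
          congr 1 with x; simp [hφx]
      _ = 0 := by rw [h1]; exact h0
  filter_upwards [him] with x hx
  apply Complex.ext
  · simp [kernel, hK]
  · simpa using hx.symm

theorem memLp_ofReal_kernel (d : ℕ) (q : ℝ) (hq : 2 < q) :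
    MemLp (fun x => ((kernel d q hq x : ℝ) : ℂ)) 2 :=
  (Lp.memLp (kernelLp d q hq)).ae_eq (kernel_ae_eq d q hq).symm

/-- The defining property: the Fourier transform of the real-valued function `K_q ∈ L²` is
`(1_𝔹)^ |(1_𝔹)^|^{q-2}`. -/
theorem kernel_spec (d : ℕ) (q : ℝ) (hq : 2 < q) :
    ((𝓕 ((memLp_ofReal_kernel d q hq).toLp (fun x => ((kernel d q hq x : ℝ) : ℂ))) : Lp (α := EuclideanSpace ℝ (Fin d)) ℂ 2 volume) :
      EuclideanSpace ℝ (Fin d) → ℂ) =ᵐ[volume] kernelHat d q := by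
  have h : (memLp_ofReal_kernel d q hq).toLp (fun x => ((kernel d q hq x : ℝ) : ℂ)) = kernelLp d q hq :=
    Lp.ext ((memLp_ofReal_kernel d q hq).coeFn_toLp.trans (kernel_ae_eq d q hq))
  rw [h, kernelLp, fourier_fourierInv_eq]
  exact (memLp_kernelHat d hq).coeFn_toLp

end FourierIndicator

end

/-! If the inequality fails, some real `c` lies strictly between the two essential bounds. Then `K_q
< c` on a positive-measure part of the ball and `K_q > c` on a positive-measure part of its
complement. Swapping equal small volumes between these parts changes `1_𝔹` by `f = 1_A - 1_B` with
`∫ f K_q > 0`, preserves volume, and stays close to the ball. Since `z ↦ ‖z‖ ^ q` is convex, its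
tangent plane at the transform of `1_𝔹`, integrated and moved to physical space by Plancherel, gives
`∫ |(1_𝔹 + f)^|^q ≥ ∫ |(1_𝔹)^|^q + q ∫ f K_q` (`integral_norm_fourier_rpow_add_le`). There is no
remainder to estimate, so local maximality is contradicted (`not_ellipsoidsLocalMax`). -/

namespace FourierIndicator

/-! ### Convexity of `‖z‖ ^ q` -/

/-- The tangent line inequality for `s ↦ s ^ q` on the nonnegative reals. -/
theorem rpow_add_mul_sub_le_rpow {q s t : ℝ} (hq : 1 ≤ q) (hs : 0 < s) (ht : 0 ≤ t) :
    s ^ q + q * s ^ (q - 1) * (t - s) ≤ t ^ q := by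
  -- Bernoulli's inequality for the ratio `t / s`, rescaled by `s ^ q`.
  have h := one_add_mul_self_le_rpow_one_add (s := t / s - 1) (p := q)
    (by have : 0 ≤ t / s := by positivity
        linarith) hq
  have hsq : 0 < s ^ q := Real.rpow_pos_of_pos hs q
  rw [add_sub_cancel, Real.div_rpow ht hs.le, le_div_iff₀ hsq] at h
  rw [Real.rpow_sub_one hs.ne']
  refine le_of_eq_of_le ?_ h
  field_simp

/-- The tangent plane inequality for the convex function `z ↦ ‖z‖ ^ q` on `ℂ`. -/
theorem norm_rpow_add_le_norm_add_rpow {q : ℝ} (hq : 2 < q) (a b : ℂ) :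
    ‖a‖ ^ q + q * (inner ℂ (a * ((‖a‖ ^ (q - 2) : ℝ) : ℂ)) b : ℂ).re ≤ ‖a + b‖ ^ q := by
  rcases eq_or_ne a 0 with rfl | ha
  · simp only [norm_zero, zero_mul, inner_zero_left, Complex.zero_re, mul_zero, zero_add]
    rw [Real.zero_rpow (by linarith), zero_add]
    positivity
  have hs : 0 < ‖a‖ := norm_pos_iff.2 ha
  have h := rpow_add_mul_sub_le_rpow (q := q) (by linarith) hs (norm_nonneg (a + b))
  refine le_trans ?_ h
  have e1 : (inner ℂ (a * ((‖a‖ ^ (q - 2) : ℝ) : ℂ)) b : ℂ).re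
      = ‖a‖ ^ (q - 2) * (inner ℂ a b : ℂ).re := by
    simp only [RCLike.inner_apply, map_mul, Complex.conj_ofReal]
    rw [show b * (starRingEnd ℂ a * ((‖a‖ ^ (q - 2) : ℝ) : ℂ))
      = ((‖a‖ ^ (q - 2) : ℝ) : ℂ) * (b * starRingEnd ℂ a) by ring, Complex.re_ofReal_mul]
  -- Cauchy–Schwarz for `a` and `a + b`, minus `‖a‖ ^ 2`; this reduces the claim to the one-variable
  -- tangent line at `‖a‖`.
  have e2 : (inner ℂ a b : ℂ).re ≤ ‖a‖ * (‖a + b‖ - ‖a‖) := by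
    have h1 : (inner ℂ a (a + b) : ℂ).re ≤ ‖a‖ * ‖a + b‖ := re_inner_le_norm (𝕜 := ℂ) a (a + b)
    have h2 : (inner ℂ a a : ℂ).re = ‖a‖ * ‖a‖ := inner_self_eq_norm_mul_norm (𝕜 := ℂ) a
    rw [inner_add_right, Complex.add_re, h2] at h1
    linarith
  have e3 : ‖a‖ ^ (q - 1) = ‖a‖ ^ (q - 2) * ‖a‖ := by
    rw [← Real.rpow_add_one hs.ne']; congr 1; ring
  have h0 : 0 ≤ ‖a‖ ^ (q - 2) := by positivity
  rw [e1, e3]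
  have := mul_le_mul_of_nonneg_left e2 (mul_nonneg (by linarith : (0 : ℝ) ≤ q) h0)
  linarith

/-! ### Subsets of prescribed volume -/

/-- A measurable set of finite volume contains measurable subsets of any smaller volume. -/
theorem exists_subset_volume_eq {d : ℕ} (hd : 1 ≤ d) {A : Set (EuclideanSpace ℝ (Fin d))}
    (hA : MeasurableSet A) (hfin : volume A ≠ ∞) {δ : ℝ} (h0 : 0 < δ)
    (hδ : δ < (volume A).toReal) :
    ∃ A' ⊆ A, MeasurableSet A' ∧ volume A' = ENNReal.ofReal δ := by
  have : Nonempty (Fin d) := ⟨⟨0, hd⟩⟩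
  have : Fact (volume A < ∞) := ⟨hfin.lt_top⟩
  -- The law of `‖x‖` on `A` has no atoms because spheres are null when `d ≥ 1`. Its distribution
  -- function is therefore continuous, and the intermediate value theorem yields the radius at which
  -- `A` is cut.
  set ν : Measure ℝ := (volume.restrict A).map (fun x => ‖x‖) with hν
  have hνa : ∀ s : Set ℝ, MeasurableSet s → ν s = volume ((fun x => ‖x‖) ⁻¹' s ∩ A) := by
    intro s hs
    rw [hν, Measure.map_apply measurable_norm hs, Measure.restrict_apply (measurable_norm hs)]
  have : NullSingletonClass ν := ⟨fun r => by
    rw [hνa _ (measurableSet_singleton r)]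
    refine measure_mono_null Set.inter_subset_left ?_
    have : (fun x : EuclideanSpace ℝ (Fin d) => ‖x‖) ⁻¹' {r} = Metric.sphere 0 r := by
      ext x; simp
    rw [this]
    exact Measure.addHaar_sphere volume 0 r⟩
  have hfinν : IsFiniteMeasure ν := by rw [hν]; infer_instance
  -- The base point `-1` lies below every norm, so no mass of `A` is lost at the lower end.
  have hcont : Continuous fun r : ℝ => ∫ _ in (-1 : ℝ)..r, (1 : ℝ) ∂ν :=
    intervalIntegral.continuous_primitive
      (fun a b => ⟨integrable_const _, integrable_const _⟩) _
  have hlim : Filter.Tendsto (fun r : ℝ => ∫ _ in (-1 : ℝ)..r, (1 : ℝ) ∂ν) Filter.atTop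
      (nhds (∫ _ in Set.Ioi (-1 : ℝ), (1 : ℝ) ∂ν)) :=
    intervalIntegral_tendsto_integral_Ioi _ (integrable_const _) Filter.tendsto_id
  have htot : ∫ _ in Set.Ioi (-1 : ℝ), (1 : ℝ) ∂ν = (volume A).toReal := by
    have : (fun x : EuclideanSpace ℝ (Fin d) => ‖x‖) ⁻¹' Set.Ioi (-1 : ℝ) ∩ A = A :=
      Set.inter_eq_right.2 fun x _ => lt_of_lt_of_le (by norm_num) (norm_nonneg x)
    rw [setIntegral_const, smul_eq_mul, mul_one, Measure.real, hνa _ measurableSet_Ioi, this]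
  rw [htot] at hlim
  obtain ⟨R, hR, hR1⟩ := ((hlim.eventually (lt_mem_nhds hδ)).and
    (Filter.eventually_ge_atTop (-1))).exists
  obtain ⟨r, hr, hrδ⟩ := intermediate_value_Icc hR1 hcont.continuousOn
    (show δ ∈ Set.Icc _ _ from ⟨by rw [intervalIntegral.integral_same]; exact h0.le, hR.le⟩)
  refine ⟨(fun x => ‖x‖) ⁻¹' Set.Ioc (-1) r ∩ A, Set.inter_subset_right,
    (measurable_norm measurableSet_Ioc).inter hA, ?_⟩
  simp only [intervalIntegral.integral_of_le hr.1] at hrδ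
  rw [← hνa _ measurableSet_Ioc, ← hrδ, setIntegral_const, smul_eq_mul, mul_one,
    ofReal_measureReal]

/-- A measurable set of positive volume contains measurable subsets of every small volume. -/
theorem exists_forall_lt_exists_subset_volume_eq {d : ℕ} (hd : 1 ≤ d)
    {A : Set (EuclideanSpace ℝ (Fin d))} (hA : MeasurableSet A) (hpos : volume A ≠ 0) :
    ∃ ε > 0, ∀ δ : ℝ, 0 < δ → δ < ε →
      ∃ A' ⊆ A, MeasurableSet A' ∧ volume A' = ENNReal.ofReal δ := by
  obtain ⟨B, hB, hBA, h0, hfin⟩ := Measure.exists_subset_measure_lt_top hA hpos.bot_lt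
  refine ⟨(volume B).toReal, ENNReal.toReal_pos h0.ne' hfin.ne, fun δ h1 h2 => ?_⟩
  obtain ⟨A', hA', h⟩ := exists_subset_volume_eq hd hB hfin.ne h1 h2
  exact ⟨A', hA'.trans hBA, h⟩

/-! ### Fourier side: integrability and first order expansion -/

/-- The Fourier integral of an integrable, square integrable function is square integrable. -/
theorem memLp_two_fourier {d : ℕ} {f : EuclideanSpace ℝ (Fin d) → ℂ} (h1 : Integrable f)
    (h2 : MemLp f 2) : MemLp (𝓕 f) 2 :=
  (Lp.memLp _).ae_eq (fourier_ae_eq h1 h2)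

/-- The transform is bounded by `‖f‖₁` and lies in `L²`, so `|f^|^q ≤ ‖f‖₁^(q-2) |f^|²` is
integrable. -/
theorem memLp_fourier {d : ℕ} {q : ℝ} (hq : 2 < q) {f : EuclideanSpace ℝ (Fin d) → ℂ}
    (h1 : Integrable f) (h2 : MemLp f 2) : MemLp (𝓕 f) (ENNReal.ofReal q) := by
  have h := memLp_two_fourier h1 h2
  have hq0 : ENNReal.ofReal q ≠ 0 := by simp; linarith
  rw [← integrable_norm_rpow_iff h.1 hq0 ENNReal.ofReal_ne_top,
    ENNReal.toReal_ofReal (by linarith)]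
  have hi := (h.integrable_norm_rpow (by norm_num) (by norm_num)).const_mul
    ((∫ x, ‖f x‖) ^ (q - 2))
  refine hi.mono (h.1.norm.aemeasurable.pow_const q).aestronglyMeasurable
    (Filter.Eventually.of_forall fun ξ => ?_)
  have hb : ‖𝓕 f ξ‖ ≤ ∫ x, ‖f x‖ :=
    VectorFourier.norm_fourierIntegral_le_integral_norm _ _ _ _ _
  rw [Real.norm_of_nonneg (by positivity), Real.norm_of_nonneg (by positivity),
    ENNReal.toReal_ofNat]
  calc ‖𝓕 f ξ‖ ^ q = ‖𝓕 f ξ‖ ^ (q - 2) * ‖𝓕 f ξ‖ ^ (2 : ℝ) := by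
        rw [← Real.rpow_add_of_nonneg (norm_nonneg _) (by linarith) (by norm_num)]
        congr 1; ring
    _ ≤ _ := by gcongr

/-- Plancherel's identity for the pairing of `K_q` with `f ∈ L¹ ∩ L²`. -/
theorem integral_inner_kernelHat_fourier {d : ℕ} {q : ℝ} (hq : 2 < q)
    {f : EuclideanSpace ℝ (Fin d) → ℂ} (h1 : Integrable f) (h2 : MemLp f 2) :
    ∫ ξ, (inner ℂ (kernelHat d q ξ) (𝓕 f ξ) : ℂ) = ∫ x, f x * (kernel d q hq x : ℂ) := by
  have h := Lp.inner_fourier_eq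
    ((memLp_ofReal_kernel d q hq).toLp (fun x => ((kernel d q hq x : ℝ) : ℂ))) (h2.toLp f)
  rw [L2.inner_def, L2.inner_def] at h
  refine Eq.trans ?_ (h.trans ?_)
  · refine integral_congr_ae ?_
    filter_upwards [kernel_spec d q hq, fourier_ae_eq h1 h2] with ξ e1 e2
    rw [e1, e2]
  · refine integral_congr_ae ?_
    filter_upwards [(memLp_ofReal_kernel d q hq).coeFn_toLp, h2.coeFn_toLp] with x e1 e2
    rw [e1, e2, RCLike.inner_apply, Complex.conj_ofReal]

/-- First order expansion of the `L^q` norm of the Fourier transform around `1_𝔹`. -/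
theorem integral_norm_fourier_rpow_add_le {d : ℕ} {q : ℝ} (hq : 2 < q)
    {f : EuclideanSpace ℝ (Fin d) → ℂ} (h1 : Integrable f) (h2 : MemLp f 2) :
    (∫ ξ, ‖𝓕 (ind (unitBall d)) ξ‖ ^ q) + q * (∫ x, f x * (kernel d q hq x : ℂ)).re
      ≤ ∫ ξ, ‖𝓕 (ind (unitBall d) + f) ξ‖ ^ q := by
  have hq0 : ENNReal.ofReal q ≠ 0 := by simp; linarith
  have hI : ∀ g : EuclideanSpace ℝ (Fin d) → ℂ, Integrable g → MemLp g 2 →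
      Integrable fun ξ => ‖𝓕 g ξ‖ ^ q := fun g g1 g2 => by
    have := (memLp_fourier hq g1 g2).integrable_norm_rpow hq0 ENNReal.ofReal_ne_top
    rwa [ENNReal.toReal_ofReal (by linarith)] at this
  have b1 := integrable_ind_unitBall d
  have b2 := memLp_ind_unitBall d 2
  have hin : Integrable fun ξ => (inner ℂ (kernelHat d q ξ) (𝓕 f ξ) : ℂ) :=
    (memLp_two_fourier h1 h2).integrable_mul (memLp_kernelHat d hq).star
  have hadd : ∀ ξ, 𝓕 (ind (unitBall d) + f) ξ = 𝓕 (ind (unitBall d)) ξ + 𝓕 f ξ := fun ξ =>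
    congrFun (VectorFourier.fourierIntegral_add Real.continuous_fourierChar
      (L := innerₗ (EuclideanSpace ℝ (Fin d))) continuous_inner b1 h1) ξ
  rw [← integral_inner_kernelHat_fourier hq h1 h2]
  have hre' : (∫ ξ, (inner ℂ (kernelHat d q ξ) (𝓕 f ξ) : ℂ)).re
    = ∫ ξ, RCLike.re (inner ℂ (kernelHat d q ξ) (𝓕 f ξ) : ℂ) := (integral_re hin).symm
  rw [hre', ← integral_const_mul, ← integral_add (hI _ b1 b2) (hin.re.const_mul q)]
  refine integral_mono ((hI _ b1 b2).add (hin.re.const_mul q)) (hI _ (b1.add h1) (b2.add h2))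
    fun ξ => ?_
  simp only [hadd]
  exact norm_rpow_add_le_norm_add_rpow hq _ _

/-- Sets of the same volume as `𝔹` are compared by `Φ_q` through `∫ |(1_E)^|^q`. -/
theorem integral_norm_fourier_rpow_le_of_Phi_le {d : ℕ} {q : ℝ} (hq : 2 < q)
    {E : Set (EuclideanSpace ℝ (Fin d))} (h1 : Integrable (ind E)) (h2 : MemLp (ind E) 2)
    (hvol : volume E = volume (unitBall d)) (hpos : volume (unitBall d) ≠ 0)
    (h : Phi q E ≤ Phi q (unitBall d)) :
    ∫ ξ, ‖𝓕 (ind E) ξ‖ ^ q ≤ ∫ ξ, ‖𝓕 (ind (unitBall d)) ξ‖ ^ q := by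
  have hq0 : ENNReal.ofReal q ≠ 0 := by simp; linarith
  have hfin := (volume_unitBall_lt_top d).ne
  -- With equal volumes the prefactors agree; being positive and finite, they cancel.
  rw [Phi, Phi, hvol, ENNReal.mul_le_mul_iff_right
    (ENNReal.rpow_pos hpos.bot_lt hfin).ne' (ENNReal.rpow_ne_top_of_ne_zero hpos hfin)] at h
  have mE := memLp_fourier hq h1 h2
  have mB := memLp_fourier hq (integrable_ind_unitBall d) (memLp_ind_unitBall d 2)
  rw [mE.eLpNorm_eq_integral_rpow_norm hq0 ENNReal.ofReal_ne_top,
    mB.eLpNorm_eq_integral_rpow_norm hq0 ENNReal.ofReal_ne_top,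
    ENNReal.toReal_ofReal (by linarith),
    ENNReal.ofReal_le_ofReal_iff (by positivity)] at h
  exact (Real.rpow_le_rpow_iff (by positivity) (by positivity) (by
    rw [inv_pos]; linarith)).1 h

theorem isEllipsoid_unitBall (d : ℕ) : IsEllipsoid (unitBall d) :=
  ⟨AffineEquiv.refl ℝ _, by simp⟩

theorem measurable_kernel (d : ℕ) (q : ℝ) (hq : 2 < q) : Measurable (kernel d q hq) :=
  Complex.measurable_re.comp (Lp.stronglyMeasurable _).measurable

theorem volume_unitBall_pos (d : ℕ) : 0 < volume (unitBall d) := by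
  have : unitBall d = Metric.closedBall 0 1 := by ext x; simp [unitBall]
  rw [this]
  exact Metric.measure_closedBall_pos volume _ one_pos

/-- `K_q` is given only as an `L²` function; on a set of finite measure this suffices for
integrability. -/
theorem integrableOn_kernel (d : ℕ) (q : ℝ) (hq : 2 < q) {A : Set (EuclideanSpace ℝ (Fin d))}
    (hA : volume A < ∞) : IntegrableOn (kernel d q hq) A := by
  have : Fact (volume A < ∞) := ⟨hA⟩
  have h := ((memLp_ofReal_kernel d q hq).restrict A).integrable (by norm_num)
  exact h.re

/-! ### Exchanging mass across the sphere -/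

section Exchange

variable {d : ℕ} {A B : Set (EuclideanSpace ℝ (Fin d))}

theorem ind_diff_union (hA : Disjoint A (unitBall d)) (hB : B ⊆ unitBall d) :
    ind (unitBall d \ B ∪ A) = ind (unitBall d) + (ind A - ind B) := by
  ext x
  have h1 : x ∈ A → x ∉ unitBall d := fun h h' => Set.disjoint_left.1 hA h h'
  have h2 : x ∈ B → x ∈ unitBall d := fun h => hB h
  by_cases a : x ∈ A <;> by_cases b : x ∈ B <;> by_cases u : x ∈ unitBall d <;>
    simp_all [ind]

theorem volume_diff_union (hA : Disjoint A (unitBall d)) (hB : B ⊆ unitBall d)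
    (mA : MeasurableSet A) (mB : MeasurableSet B) (h : volume A = volume B) :
    volume (unitBall d \ B ∪ A) = volume (unitBall d) := by
  rw [measure_union (hA.symm.mono_left Set.sdiff_subset) mA, h, add_comm]
  have := measure_inter_add_sdiff (μ := volume) (unitBall d) mB
  rwa [Set.inter_eq_right.2 hB] at this

theorem symmDiff_diff_union_subset : unitBall d ∆ (unitBall d \ B ∪ A) ⊆ A ∪ B := by
  intro x hx
  simp only [Set.mem_symmDiff, Set.mem_union, Set.mem_sdiff] at hx ⊢
  tauto

/-- The unit ball itself competes in the infimum, since the exchange preserves its volume. -/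
theorem distEllipsoids_diff_union_le (hA : Disjoint A (unitBall d)) (hB : B ⊆ unitBall d)
    (mA : MeasurableSet A) (mB : MeasurableSet B) (h : volume A = volume B) :
    distEllipsoids (unitBall d \ B ∪ A) ≤ (volume A + volume B) / volume (unitBall d) := by
  have hv := volume_diff_union hA hB mA mB h
  refine (iInf₂_le_of_le _ (isEllipsoid_unitBall d) (iInf_le _ hv.symm)).trans ?_
  rw [hv]
  gcongr
  exact (measure_mono symmDiff_diff_union_subset).trans (measure_union_le _ _)

/-- Moving mass from where `K_q < c` to where `K_q > c` increases the integral of `K_q`. -/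
theorem integral_ind_sub_ind_mul_kernel_pos {q c : ℝ} (hq : 2 < q)
    (mA : MeasurableSet A) (mB : MeasurableSet B) (h : volume A = volume B)
    (hpos : 0 < volume A) (hfin : volume A < ∞) (hAc : ∀ x ∈ A, c < kernel d q hq x)
    (hBc : ∀ x ∈ B, kernel d q hq x < c) :
    0 < (∫ x, (ind A - ind B) x * (kernel d q hq x : ℂ)).re := by
  have iA := integrableOn_kernel d q hq hfin
  have iB := integrableOn_kernel d q hq (h ▸ hfin)
  have e : ∀ x, (ind A - ind B) x * (kernel d q hq x : ℂ)
      = ((A.indicator (kernel d q hq) x - B.indicator (kernel d q hq) x : ℝ) : ℂ) := fun x => by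
    by_cases a : x ∈ A <;> by_cases b : x ∈ B <;> simp [ind, a, b]
  simp only [e]
  rw [integral_complex_ofReal, Complex.ofReal_re, integral_sub (iA.integrable_indicator mA)
    (iB.integrable_indicator mB), integral_indicator mA, integral_indicator mB]
  have hB : ∫ x in B, kernel d q hq x ≤ ∫ _ in B, c :=
    setIntegral_mono_on iB (integrableOn_const (h ▸ hfin).ne) mB fun x hx => (hBc x hx).le
  have iAc : IntegrableOn (fun _ : EuclideanSpace ℝ (Fin d) => c) A := integrableOn_const hfin.ne
  -- Strictness comes from `A` alone: a positive integrand on a set of positive measure. On `B` the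
  -- weak bound is enough.
  have hA : 0 < ∫ x in A, (kernel d q hq x - c) := by
    rw [setIntegral_pos_iff_support_of_nonneg_ae
      ((ae_restrict_iff' mA).2 (Filter.Eventually.of_forall fun x hx =>
        (sub_pos.2 (hAc x hx)).le)) (iA.sub iAc)]
    refine hpos.trans_le (measure_mono fun x hx => ⟨?_, hx⟩)
    exact (sub_pos.2 (hAc x hx)).ne'
  rw [integral_sub iA iAc] at hA
  rw [setIntegral_const] at hA hB
  rw [Measure.real, h] at hA
  rw [Measure.real] at hB
  linarith

/-- A small exchange of mass that increases the integral of `K_q` violates local maximality. -/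
theorem not_ellipsoidsLocalMax {q c : ℝ} (hq : 2 < q) (hd : 1 ≤ d)
    (mA : MeasurableSet A) (mB : MeasurableSet B) (hA : Disjoint A (unitBall d))
    (hB : B ⊆ unitBall d) (A0 : volume A ≠ 0) (B0 : volume B ≠ 0)
    (hAc : ∀ x ∈ A, c < kernel d q hq x) (hBc : ∀ x ∈ B, kernel d q hq x < c) :
    ¬ EllipsoidsLocalMax d q := by
  rintro ⟨η, hη, hmax⟩
  obtain ⟨a, ha, hA'⟩ := exists_forall_lt_exists_subset_volume_eq hd mA A0
  obtain ⟨b, hb, hB'⟩ := exists_forall_lt_exists_subset_volume_eq hd mB B0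
  have hVpos := volume_unitBall_pos d
  have hVfin := volume_unitBall_lt_top d
  have hv := ENNReal.toReal_pos hVpos.ne' hVfin.ne
  -- Both sets must contain subsets of volume `δ`, and the distance bound `2δ / |𝔹|` must be below
  -- `η`; this explains the third term of the minimum.
  obtain ⟨δ, hδ, hδlt⟩ := exists_between
    (lt_min (lt_min ha hb) (show 0 < η * (volume (unitBall d)).toReal / 2 by positivity))
  obtain ⟨hδab, hδη⟩ := lt_min_iff.1 hδlt
  obtain ⟨hδa, hδb⟩ := lt_min_iff.1 hδab
  obtain ⟨A', sA, mA', vA⟩ := hA' δ hδ hδa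
  obtain ⟨B', sB, mB', vB⟩ := hB' δ hδ hδb
  have dA : Disjoint A' (unitBall d) := hA.mono_left sA
  have dB : B' ⊆ unitBall d := sB.trans hB
  have hAB : volume A' = volume B' := vA.trans vB.symm
  have hfin : volume A' < ∞ := vA ▸ ENNReal.ofReal_lt_top
  have memLp_ind : ∀ {S : Set (EuclideanSpace ℝ (Fin d))}, MeasurableSet S → volume S < ∞ →
      ∀ p, MemLp (ind S) p := fun mS hS p =>
    memLp_indicator_const p mS 1 (Or.inr hS.ne)
  have f2 : MemLp (ind A' - ind B') 2 :=
    (memLp_ind mA' hfin 2).sub (memLp_ind mB' (hAB ▸ hfin) 2)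
  have f1 : Integrable (ind A' - ind B') := memLp_one_iff_integrable.1
    ((memLp_ind mA' hfin 1).sub (memLp_ind mB' (hAB ▸ hfin) 1))
  have mE : MeasurableSet (unitBall d \ B' ∪ A') :=
    ((measurableSet_unitBall d).diff mB').union mA'
  have hE := volume_diff_union dA dB mA' mB' hAB
  have hdist : distEllipsoids (unitBall d \ B' ∪ A') < ENNReal.ofReal η := by
    refine (distEllipsoids_diff_union_le dA dB mA' mB' hAB).trans_lt ?_
    rw [vA, vB, ← ENNReal.ofReal_add hδ.le hδ.le, ← ENNReal.ofReal_toReal hVfin.ne,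
      ← ENNReal.ofReal_div_of_pos hv, ENNReal.ofReal_lt_ofReal_iff hη, div_lt_iff₀ hv]
    linarith
  have hle := integral_norm_fourier_rpow_le_of_Phi_le hq
    (memLp_one_iff_integrable.1 (memLp_ind mE (hE ▸ hVfin) 1)) (memLp_ind mE (hE ▸ hVfin) 2)
    hE hVpos.ne' (hmax _ mE.nullMeasurableSet (hE ▸ hVpos) (hE ▸ hVfin) hdist)
  rw [ind_diff_union dA dB] at hle
  have hexp := integral_norm_fourier_rpow_add_le hq f1 f2
  have hK := integral_ind_sub_ind_mul_kernel_pos hq mA' mB' hAB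
    (vA ▸ ENNReal.ofReal_pos.2 hδ) hfin (fun x hx => hAc x (sA hx)) fun x hx => hBc x (sB hx)
  have : 0 < q * (∫ x, (ind A' - ind B') x * (kernel d q hq x : ℂ)).re :=
    mul_pos (by linarith) hK
  linarith

end Exchange

end FourierIndicator

/-! ### Conclusion -/

theorem proposition2p4 (d : ℕ) (hd : 1 ≤ d) (q : ℝ) (hq : 2 < q)
    (hmax : FourierIndicator.EllipsoidsLocalMax d q) :
    essSup (fun x => ((FourierIndicator.kernel d q hq x : ℝ) : EReal))
        (volume.restrict {x : EuclideanSpace ℝ (Fin d) | 1 ≤ ‖x‖}) ≤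
      essInf (fun x => ((FourierIndicator.kernel d q hq x : ℝ) : EReal))
        (volume.restrict {x : EuclideanSpace ℝ (Fin d) | ‖x‖ ≤ 1}) := by
  by_contra! hlt
  obtain ⟨c, hinf, hsup⟩ := EReal.lt_iff_exists_real_btwn.1 hlt
  have hA := frequently_ae_iff.1 (Filter.frequently_lt_of_lt_limsup (by isBoundedDefault) hsup)
  have hB := frequently_ae_iff.1 (Filter.frequently_lt_of_liminf_lt (by isBoundedDefault) hinf)
  simp only [EReal.coe_lt_coe_iff] at hA hB
  have mK := FourierIndicator.measurable_kernel d q hq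
  have mA : MeasurableSet {x | c < FourierIndicator.kernel d q hq x} :=
    measurableSet_lt measurable_const mK
  have mB : MeasurableSet {x | FourierIndicator.kernel d q hq x < c} :=
    measurableSet_lt mK measurable_const
  rw [Measure.restrict_apply mA] at hA
  rw [Measure.restrict_apply mB] at hB
  have : Nonempty (Fin d) := ⟨⟨0, hd⟩⟩
  -- `A` must be disjoint from the closed ball, hence `1 < ‖x‖` in place of `1 ≤ ‖x‖`; the sphere
  -- dropped here is null.
  refine FourierIndicator.not_ellipsoidsLocalMax (c := c)
    (A := {x | c < FourierIndicator.kernel d q hq x} ∩ {x | 1 < ‖x‖})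
    (B := {x | FourierIndicator.kernel d q hq x < c} ∩ {x | ‖x‖ ≤ 1}) hq hd
    (mA.inter (measurableSet_lt measurable_const measurable_norm))
    (mB.inter (FourierIndicator.measurableSet_unitBall d))
    (Set.disjoint_left.2 fun x hx hx' => (show 1 < ‖x‖ from hx.2).not_ge hx') Set.inter_subset_right ?_ hB
    (fun x hx => hx.1) (fun x hx => hx.1) hmax
  refine fun h0 => hA (measure_mono_null ?_
    (measure_union_null h0 (Measure.addHaar_sphere volume (0 : EuclideanSpace ℝ (Fin d)) 1)))
  rintro x ⟨h1, h2⟩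
  rcases (show 1 ≤ ‖x‖ from h2).lt_or_eq with h | h
  · exact Or.inl ⟨h1, h⟩
  · exact Or.inr (by simpa using h.symm)
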